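/- Let $d,T\ge 1$ be integers, let $D_d\subset\mathbb{R}^d$ be bounded, and let $\mathcal I_d\subset (D_d)^{\mathbb{Z}_-}$ be a set of input sequences, where $\mathbb{Z}_-=\{\dots,-2,-1,0\}$. Let $\sigma_1(x)=x$ and $\sigma_2(x)=\max(x,0)$. For $N\ge 1$ let $\mathcal C_N$ be the set of functionals $H:\mathcal I_d\to\mathbb{R}$ for which there are a Borel probability measure $\mu$ on $\mathbb{R}\times\mathbb{R}^N\times\mathbb{R}^d\times\mathbb{R}$, matrices $A\in\mathbb{R}^{N\times N}$, $C\in\mathbb{R}^{N\times d}$ and a vector $\mathbf B\in\mathbb{R}^N$ such that $\int |w|(\|\mathbf a\|+\|\mathbf c\|+|b|)\,\mu(dw,d\mathbf a,d\mathbf c,db)<\infty$ and, for each $\mathbf z\in\mathcal I_d$, the system $\mathbf x_t=\sigma_1(A\mathbf x_{t-1}+C\mathbf z_t+\mathbf B)$, $t\in\mathbb{Z}_-$, has a unique bounded solution $\mathbf x(\mathbf z)=(\mathbf x_t)_{t\in\mathbb{Z}_-}$ in $\mathbb{R}^N$, with $$H(\mathbf z)=\int w\,\sigma_2(\mathbf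 a\cdot\mathbf x_{-1}(\mathbf z)+\mathbf c\cdot\mathbf z_0+b)\,\mu(dw,d\mathbf a,d\mathbf c,db).$$ The elements of the sets $\mathcal C_N$ are called finite-dimensional recurrent Barron functionals. Let $h:\mathbb{R}^{Td}\to\mathbb{R}$ be in the Sobolev space $H^s(\mathbb{R}^{Td})$ for some real $s>\frac{Td}{2}+2$. Then $h$ agrees almost everywhere with a continuous function, which is again denoted by $h$, and the functional $$H(\mathbf z)=h(\mathbf z_0,\mathbf z_{-1},\dots,\mathbf z_{-T+1}),\qquad \mathbf z\in\mathcal I_d,$$ is a finite-dimensional recurrent Barron functional. Moreover, it is realized as above with $N=Td$, $\mathbf B=\mathbf 0$ and the linear shift state equation given by $$A=\begin{pmatrix}\mathbf 0_{d,d(T-1)}&\mathbf 0_{d,d}\\ \mathbb I_{d(T-1)}&\mathbf 0_{d(T-1),d}\end{pmatrix},\qquad C=\begin{pmatrix}\mathbb I_d\\ \mathbf 0_{d(T-1),d}\end{pmatrix}.$$ -/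

import Mathlib

open MeasureTheory
open scoped ENNReal SchwartzMap

noncomputable section

namespace RecurrentBarron

/-- The index set `ℤ₋ = {…, -2, -1, 0}`. -/
abbrev NonposInt : Type := {t : ℤ // t ≤ 0}

/-- The time `-k`. -/
def lag (k : ℕ) : NonposInt := ⟨-(k : ℤ), by omega⟩

/-- The preceding time `t - 1`. -/
def prev (t : NonposInt) : NonposInt := ⟨t.1 - 1, by have := t.2; omega⟩

/-- `ℝ^n` with the Euclidean norm. -/
abbrev Vec (n : ℕ) : Type := EuclideanSpace ℝ (Fin n)

/-- The parameter space `ℝ × ℝ^N × ℝ^d × ℝ`, with elements `(w, a, c, b)`; its measurable structure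
is the product one, which is the Borel one. -/
abbrev Params (N d : ℕ) : Type := ℝ × Vec N × Vec d × ℝ

/-- `x` satisfies `x_t = σ₁(A x_{t-1} + C z_t + B)` for all `t ∈ ℤ₋`, where `σ₁` acts
componentwise. -/
def IsSolution {N d : ℕ} (σ₁ : ℝ → ℝ) (A : Matrix (Fin N) (Fin N) ℝ) (B : Vec N)
    (C : Matrix (Fin N) (Fin d) ℝ) (z : NonposInt → Vec d) (x : NonposInt → Vec N) : Prop :=
  ∀ t i, x t i =
    σ₁ (A.mulVec (WithLp.ofLp (x (prev t))) i + C.mulVec (WithLp.ofLp (z t)) i + B i)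

/-- The integrand `w σ₂(a · x + c · u + b)` of the readout. -/
def readout {N d : ℕ} (σ₂ : ℝ → ℝ) (x : Vec N) (u : Vec d) (θ : Params N d) : ℝ :=
  θ.1 * σ₂ (inner ℝ θ.2.1 x + inner ℝ θ.2.2.1 u + θ.2.2.2)

/-- The parameters `A, B, C` and the measure `μ` realize the functional `H` on the input set `I`:
`μ` is a probability measure with `∫ |w| (‖a‖ + ‖c‖ + |b|) dμ < ∞`, and for every input `z` the
state equation has exactly one bounded solution `x`, with
`H z = ∫ w σ₂(a · x_{-1} + c · z_0 + b) dμ` (the integral being convergent). -/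
structure IsRealization {N d : ℕ} (σ₁ σ₂ : ℝ → ℝ) (I : Set (NonposInt → Vec d))
    (A : Matrix (Fin N) (Fin N) ℝ) (B : Vec N) (C : Matrix (Fin N) (Fin d) ℝ)
    (μ : Measure (Params N d)) (H : I → ℝ) : Prop where
  prob : IsProbabilityMeasure μ
  moment : Integrable (fun θ : Params N d => |θ.1| * (‖θ.2.1‖ + ‖θ.2.2.1‖ + |θ.2.2.2|)) μ
  eq_readout : ∀ z : I, ∃ x : NonposInt → Vec N,
    (Memℓp x ∞ ∧ IsSolution σ₁ A B C z.1 x) ∧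
    (∀ y : NonposInt → Vec N, Memℓp y ∞ → IsSolution σ₁ A B C z.1 y → y = x) ∧
    Integrable (readout σ₂ (x (lag 1)) (z.1 (lag 0))) μ ∧
    H z = ∫ θ, readout σ₂ (x (lag 1)) (z.1 (lag 0)) θ ∂μ

/-- The class `𝒞_N` of functionals on `I` realized by systems with an `N`-dimensional state. -/
def barronClass {d : ℕ} (σ₁ σ₂ : ℝ → ℝ) (N : ℕ) (I : Set (NonposInt → Vec d)) : Set (I → ℝ) :=
  {H | ∃ (μ : Measure (Params N d)) (A : Matrix (Fin N) (Fin N) ℝ) (B : Vec N)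
    (C : Matrix (Fin N) (Fin d) ℝ), IsRealization σ₁ σ₂ I A B C μ H}

/-- Finite-dimensional recurrent Barron functionals: the elements of some `𝒞_N`, `N ≥ 1`. -/
def IsFiniteDimBarron {d : ℕ} (σ₁ σ₂ : ℝ → ℝ) (I : Set (NonposInt → Vec d)) (H : I → ℝ) : Prop :=
  ∃ N : ℕ, 1 ≤ N ∧ H ∈ barronClass σ₁ σ₂ N I

/-- The block matrix `[[0, 0], [𝕀, 0]]` on `(ℝ^d)^T = ℝ^(Td)`, which moves every block one place
down and puts `0` in the first block. -/
def shiftMatrix (T d : ℕ) : Matrix (Fin (T * d)) (Fin (T * d)) ℝ :=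
  fun i j => if i.1 = j.1 + d then 1 else 0

/-- The block matrix `[𝕀; 0]`, which writes a vector of `ℝ^d` into the first block of
`(ℝ^d)^T = ℝ^(Td)`. -/
def inputMatrix (T d : ℕ) : Matrix (Fin (T * d)) (Fin d) ℝ :=
  fun i j => if i.1 = j.1 then 1 else 0

/-- The vector `(u_0, …, u_{T-1})` of `ℝ^(Td)`: its entry at `d k + j` is the entry `j` of `u_k`. -/
def stack {T d : ℕ} (u : Fin T → Vec d) : Vec (T * d) :=
  WithLp.toLp 2 fun i => u (finProdFinEquiv.symm i).1 (finProdFinEquiv.symm i).2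

/-- The functional `z ↦ h(z_0, z_{-1}, …, z_{-T+1})` on the input set `I`. -/
def finiteMemory {T d : ℕ} (I : Set (NonposInt → Vec d)) (h : Vec (T * d) → ℝ) : I → ℝ :=
  fun z => h (stack fun k : Fin T => z.1 (lag k.1))

/-- `h` belongs to the Sobolev space `H^s(ℝ^n)`, `s ≥ 0`: it is square integrable and
`𝓕⁻¹ (1 + ‖ξ‖²)^(s/2) 𝓕 h` is square integrable. -/
def MemHs {n : ℕ} (s : ℝ) (h : Vec n → ℝ) : Prop :=
  ∃ hL : MemLp (fun x => (h x : ℂ)) 2 (volume : Measure (Vec n)),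
    TemperedDistribution.MemSobolev s 2 ((hL.toLp _ : Lp ℂ 2 (volume : Measure (Vec n))) :
      𝓢'(Vec n, ℂ))

end RecurrentBarron

end

/-! Since `s > n/2 + 2` with `n = T * d`, the Fourier transform `w` of `h` satisfies `∫ (1 + ‖ξ‖²)
‖w‖ < ∞`, so `h` is a.e. the continuous superposition of plane waves `exp(2πi⟪ξ,u⟫) w(ξ)`
(`MemHs.exists_planeWave`). On a ball of radius `R` the phase lies in `[-M, M]`, `M = 2πR‖ξ‖`.
Shifted by `M` it is nonnegative, where Taylor's formula writes the exponential as an integral of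
ReLUs against a bounded density (`integral_relu_mul_reluKernel`). The range of thresholds and the
size of the ReLU parameters are both `O(1 + ‖ξ‖)`; this is why second moments of `w` are needed.
Fubini and a change to a probability measure give a ReLU readout of `u`
(`exists_relu_representation`). Finally, the shift register stores `u = (z_0, …, z_{-T+1})` as its
state `x_0 = A x_{-1} + C z_0`, so `⟪a, u⟫ = ⟪Aᵀa, x_{-1}⟫ + ⟪Cᵀa, z_0⟫`, and pushing the measure
forward along `a ↦ (Aᵀa, Cᵀa)` gives the realization (`exists_isRealization_shift`). -/

namespace RecurrentBarron

/-! ### Plane waves as superpositions of ReLUs -/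

/-- A bounded density `k` on `[-1, ∞)` with `∫_{-1}^L (t - s)₊ k(s) ds = exp(it)` for
`0 ≤ t ≤ L`. -/
noncomputable def reluKernel (s : ℝ) : ℂ :=
  -- The affine piece is determined by `∫ k = i` and `∫ s k = -1` over `[-1, 0]`, so that it
  -- contributes `1 + it`; for `s > 0` the density is the second derivative of `exp(is)`.
  if s ≤ 0 then (4 * Complex.I - 6) - (12 - 6 * Complex.I) * s else -Complex.exp (s * Complex.I)

lemma measurable_reluKernel : Measurable reluKernel := by
  unfold reluKernel
  refine Measurable.ite measurableSet_Iic ?_ ?_ <;> fun_prop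

lemma norm_reluKernel_le {s : ℝ} (hs : -1 ≤ s) : ‖reluKernel s‖ ≤ 28 := by
  unfold reluKernel
  split_ifs with h
  · have h1 : ‖(s : ℂ)‖ ≤ 1 := by
      rw [Complex.norm_real, Real.norm_eq_abs, abs_le]; constructor <;> linarith
    have h2 : ‖(4 * Complex.I - 6 : ℂ)‖ ≤ 10 := by
      refine (norm_sub_le _ _).trans ?_
      simp; norm_num
    have h3 : ‖(12 - 6 * Complex.I : ℂ)‖ ≤ 18 := by
      refine (norm_sub_le _ _).trans ?_
      simp; norm_num
    refine (norm_sub_le _ _).trans ?_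
    rw [norm_mul]
    nlinarith [norm_nonneg (s : ℂ), norm_nonneg (12 - 6 * Complex.I : ℂ)]
  · rw [norm_neg, Complex.norm_exp_ofReal_mul_I]; norm_num

/-- Taylor's formula `exp(it) = (1 + it) - ∫_0^t (t - s) exp(is) ds`: the part over `[-1, 0]`
supplies the affine term, the part over `[0, t]` the remainder, and the ReLU vanishes beyond `t`. -/
lemma integral_relu_mul_reluKernel {t L : ℝ} (ht : 0 ≤ t) (hL : t ≤ L) :
    ∫ s in (-1)..L, ((max (t - s) 0 : ℝ) : ℂ) * reluKernel s = Complex.exp (t * Complex.I) := by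
  have e1 : Set.EqOn (fun s : ℝ => ((max (t - s) 0 : ℝ) : ℂ) * reluKernel s)
      (fun s : ℝ => (t - s : ℂ) * ((4 * Complex.I - 6) - (12 - 6 * Complex.I) * s))
      (Set.Ioc (-1) 0) := fun s hs => by
    have : 0 ≤ t - s := by linarith [hs.2]
    simp only [reluKernel, if_pos hs.2, max_eq_left this]
    push_cast; ring
  have e2 : Set.EqOn (fun s : ℝ => ((max (t - s) 0 : ℝ) : ℂ) * reluKernel s)
      (fun s : ℝ => -((t - s : ℂ) * Complex.exp (s * Complex.I))) (Set.Ioc 0 t) := fun s hs => by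
    have : 0 ≤ t - s := by linarith [hs.2]
    simp only [reluKernel, if_neg (not_le.2 hs.1), max_eq_left this]
    push_cast; ring
  have e3 : Set.EqOn (fun s : ℝ => ((max (t - s) 0 : ℝ) : ℂ) * reluKernel s)
      (fun _ : ℝ => 0) (Set.Ioc t L) := fun s hs => by
    have : t - s ≤ 0 := by linarith [hs.1]
    simp [max_eq_right this]
  have d1 : ∀ s ∈ Set.uIcc (-1 : ℝ) 0, HasDerivAt
      (fun s : ℝ => ((4 * Complex.I - 6) * t) * (s : ℂ)
        - ((4 * Complex.I - 6) + (12 - 6 * Complex.I) * t) * ((s : ℂ) ^ 2 / 2)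
        + (12 - 6 * Complex.I) * ((s : ℂ) ^ 3 / 3))
      ((t - s : ℂ) * ((4 * Complex.I - 6) - (12 - 6 * Complex.I) * s)) s := fun s _ => by
    have h : HasDerivAt (fun x : ℝ => (x : ℂ)) 1 s :=
      (hasDerivAt_id s).ofReal_comp
    convert! ((h.const_mul ((4 * Complex.I - 6) * (t : ℂ))).sub
      (((h.pow 2).div_const 2).const_mul ((4 * Complex.I - 6) + (12 - 6 * Complex.I) * (t : ℂ)))).add
      (((h.pow 3).div_const 3).const_mul (12 - 6 * Complex.I)) using 1
    simp; ring
  have d2 : ∀ s ∈ Set.uIcc (0 : ℝ) t, HasDerivAt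
      (fun s : ℝ => (t - s : ℂ) * (Complex.exp (s * Complex.I) * Complex.I)
        + Complex.exp (s * Complex.I))
      (-(((t - s : ℂ)) * Complex.exp (s * Complex.I))) s := fun s _ => by
    have h : HasDerivAt (fun x : ℝ => (x : ℂ)) 1 s :=
      (hasDerivAt_id s).ofReal_comp
    have hE := (h.mul_const Complex.I).cexp
    convert! ((h.const_sub (t : ℂ)).mul (hE.mul_const Complex.I)).add hE using 1
    linear_combination (-((t - s : ℂ)) * Complex.exp (s * Complex.I)) * Complex.I_mul_I
  have c1 : Continuous fun s : ℝ =>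
      (t - s : ℂ) * ((4 * Complex.I - 6) - (12 - 6 * Complex.I) * s) := by fun_prop
  have c2 : Continuous fun s : ℝ => -((t - s : ℂ) * Complex.exp (s * Complex.I)) := by fun_prop
  have i1 : IntervalIntegrable (fun s : ℝ => ((max (t - s) 0 : ℝ) : ℂ) * reluKernel s)
      volume (-1) 0 := by
    refine (c1.intervalIntegrable _ _).congr ?_
    rw [Set.uIoc_of_le (by norm_num)]
    exact e1.symm
  have i2 : IntervalIntegrable (fun s : ℝ => ((max (t - s) 0 : ℝ) : ℂ) * reluKernel s)
      volume 0 t := by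
    refine (c2.intervalIntegrable _ _).congr ?_
    rw [Set.uIoc_of_le ht]
    exact e2.symm
  have i3 : IntervalIntegrable (fun s : ℝ => ((max (t - s) 0 : ℝ) : ℂ) * reluKernel s)
      volume t L := by
    refine (continuous_const.intervalIntegrable (μ := volume) t L (u := fun _ => (0 : ℂ))).congr ?_
    rw [Set.uIoc_of_le hL]
    exact e3.symm
  rw [← intervalIntegral.integral_add_adjacent_intervals (i1.trans i2) i3,
    ← intervalIntegral.integral_add_adjacent_intervals i1 i2,
    intervalIntegral.integral_congr_ae (g := fun s : ℝ =>
      (t - s : ℂ) * ((4 * Complex.I - 6) - (12 - 6 * Complex.I) * s))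
      (Filter.Eventually.of_forall fun s hs => e1 (by rwa [Set.uIoc_of_le (by norm_num)] at hs)),
    intervalIntegral.integral_congr_ae (a := 0) (g := fun s : ℝ =>
      -((t - s : ℂ) * Complex.exp (s * Complex.I)))
      (Filter.Eventually.of_forall fun s hs => e2 (by rwa [Set.uIoc_of_le ht] at hs)),
    intervalIntegral.integral_congr_ae (a := t) (g := fun s : ℝ => (0 : ℂ))
      (Filter.Eventually.of_forall fun s hs => e3 (by rwa [Set.uIoc_of_le hL] at hs)),
    intervalIntegral.integral_eq_sub_of_hasDerivAt d1 (c1.intervalIntegrable _ _),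
    intervalIntegral.integral_eq_sub_of_hasDerivAt d2 (c2.intervalIntegrable _ _)]
  simp
  ring

/-- Integrals against a signed density of a `σ`-finite measure are integrals, with a weight, against
a probability measure. -/
lemma exists_isProbabilityMeasure_weight {Θ : Type*} [MeasurableSpace Θ] (ν : Measure Θ)
    [SigmaFinite ν] [NeZero ν] {ρ : Θ → ℝ} (hρ : Measurable ρ) :
    ∃ (P : Measure Θ) (ω : Θ → ℝ), IsProbabilityMeasure P ∧ Measurable ω ∧
      (∀ f : Θ → ℝ, Integrable (fun x => ρ x * f x) ν → Integrable (fun x => ω x * f x) P) ∧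
      (∀ f : Θ → ℝ, Integrable (fun x => |ρ x| * f x) ν → Integrable (fun x => |ω x| * f x) P) ∧
      ∀ f : Θ → ℝ, ∫ x, ω x * f x ∂P = ∫ x, ρ x * f x ∂ν := by
  -- `ν.toFinite` is a probability measure dominating `ν`; the Radon–Nikodym derivative is absorbed
  -- into the weight.
  have hac : ν ≪ ν.toFinite := absolutelyContinuous_toFinite ν
  refine ⟨ν.toFinite, fun x => (ν.rnDeriv ν.toFinite x).toReal * ρ x, inferInstance,
    (Measure.measurable_rnDeriv _ _).ennreal_toReal.mul hρ, fun f hf => ?_, fun f hf => ?_,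
    fun f => ?_⟩
  · simpa only [smul_eq_mul, mul_assoc] using (integrable_rnDeriv_smul_iff hac).2 hf
  · simpa only [smul_eq_mul, mul_assoc, abs_mul, abs_of_nonneg ENNReal.toReal_nonneg]
      using (integrable_rnDeriv_smul_iff hac).2 hf
  · simpa only [smul_eq_mul, mul_assoc] using integral_rnDeriv_smul hac (f := fun x => ρ x * f x)

open scoped RealInnerProductSpace in
/-- A superposition of plane waves with finite second spectral moment is, on a ball, a superposition
of rectified affine functions with finite first moment. -/
theorem exists_relu_representation {V : Type*} [NormedAddCommGroup V] [InnerProductSpace ℝ V]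
    [FiniteDimensional ℝ V] [MeasurableSpace V] [BorelSpace V]
    {w : V → ℂ} (hw : Measurable w) (hw0 : Integrable w)
    (hw2 : Integrable fun ξ => ‖ξ‖ ^ 2 * ‖w ξ‖) {R : ℝ} (hR : 0 ≤ R) :
    ∃ μ : Measure (ℝ × V × ℝ), IsProbabilityMeasure μ ∧
      Integrable (fun θ : ℝ × V × ℝ => |θ.1| * (‖θ.2.1‖ + |θ.2.2|)) μ ∧
      ∀ u : V, ‖u‖ ≤ R →
        Integrable (fun θ : ℝ × V × ℝ => θ.1 * max (⟪θ.2.1, u⟫ + θ.2.2) 0) μ ∧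
        ∫ θ : ℝ × V × ℝ, θ.1 * max (⟪θ.2.1, u⟫ + θ.2.2) 0 ∂μ =
          (∫ ξ, Complex.exp ((2 * Real.pi * ⟪ξ, u⟫ : ℝ) * Complex.I) * w ξ).re := by
  set M : V → ℝ := fun ξ => 2 * Real.pi * R * ‖ξ‖ with hM
  -- Affine parametrization of the threshold interval `[-1, 2M]` by `σ ∈ [0, 1]`. Its Jacobian `2M +
  -- 1` enters `ρ'`, and the factor `exp(-iM)` undoes the shift of the phase.
  set S : V × ℝ → ℝ := fun p => -1 + (2 * M p.1 + 1) * p.2 with hS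
  set ν : Measure (V × ℝ) := (volume : Measure V).prod (volume.restrict (Set.Ioc 0 1)) with hν
  set ρ' : V × ℝ → ℂ := fun p => ((2 * M p.1 + 1 : ℝ) : ℂ) *
    (w p.1 * Complex.exp ((-M p.1 : ℝ) * Complex.I) * reluKernel (S p)) with hρ'
  set ρ : V × ℝ → ℝ := fun p => (ρ' p).re with hρ
  have hMm : Measurable M := by fun_prop
  have hM0 : ∀ ξ, 0 ≤ M ξ := fun ξ => by positivity
  have hSm : Measurable S := by fun_prop
  have hk := measurable_reluKernel
  have hρ'm : Measurable ρ' := by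
    have := hk.comp hSm
    have h2 : Measurable fun p : V × ℝ => w p.1 := hw.comp measurable_fst
    simp only [Function.comp_def] at this
    fun_prop
  have hρm : Measurable ρ := Complex.measurable_re.comp hρ'm
  have : NeZero ν := ⟨by
    rw [Ne, ← Measure.measure_univ_eq_zero, hν, ← Set.univ_prod_univ, Measure.prod_prod]
    simpa using NeZero.ne (volume : Measure V)⟩
  have hS1 : ∀ ξ, ∀ σ ∈ Set.Ioc (0 : ℝ) 1, -1 ≤ S (ξ, σ) ∧ |M ξ - S (ξ, σ)| ≤ M ξ + 1 := by
    intro ξ σ hσ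
    have h1 : 0 ≤ (2 * M ξ + 1) * σ := mul_nonneg (by linarith [hM0 ξ]) hσ.1.le
    have h2 : (2 * M ξ + 1) * σ ≤ 2 * M ξ + 1 :=
      mul_le_of_le_one_right (by linarith [hM0 ξ]) hσ.2
    simp only [hS, abs_le]
    refine ⟨by linarith, by linarith, by linarith⟩
  have hae : ∀ {p : V × ℝ → Prop}, (∀ ξ, ∀ σ ∈ Set.Ioc (0 : ℝ) 1, p (ξ, σ)) → ∀ᵐ x ∂ν, p x := by
    intro p hp
    have h1 : ∀ᵐ σ ∂(volume.restrict (Set.Ioc (0 : ℝ) 1)), σ ∈ Set.Ioc (0 : ℝ) 1 :=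
      ae_restrict_mem measurableSet_Ioc
    have h2 := Measure.quasiMeasurePreserving_snd (μ := (volume : Measure V))
      (ν := volume.restrict (Set.Ioc (0 : ℝ) 1)) |>.ae h1
    filter_upwards [h2] with x hx using hp x.1 x.2 hx
  -- the dominating function
  set c : ℝ := 2 * Real.pi * R with hc
  have hc0 : 0 ≤ c := by positivity
  have hdom : Integrable (fun p : V × ℝ =>
      28 * ((2 * M p.1 + 1) * (2 * Real.pi * ‖p.1‖ + 2 * M p.1 + 1) * ‖w p.1‖)) ν := by
    have : Integrable (fun ξ : V =>
        28 * ((2 * M ξ + 1) * (2 * Real.pi * ‖ξ‖ + 2 * M ξ + 1) * ‖w ξ‖)) := by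
      refine (((hw0.norm.add hw2).const_mul
        -- The coefficients come from expanding `(2cx + 1)((2π + 2c)x + 1)` at `x = ‖ξ‖`, with `x`
        -- and `1` bounded by `1 + x²`.
        (28 * (2 * c * (2 * Real.pi + 2 * c) + (4 * c + 2 * Real.pi) + 1)))).mono' ?_ ?_
      · have := hw.norm
        exact Measurable.aestronglyMeasurable (by fun_prop)
      · refine Filter.Eventually.of_forall fun ξ => ?_
        have hx := norm_nonneg ξ
        have hpi := Real.pi_pos
        rw [Real.norm_of_nonneg (by have := hM0 ξ; positivity)]
        have hp : (2 * M ξ + 1) * (2 * Real.pi * ‖ξ‖ + 2 * M ξ + 1) ≤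
            (2 * c * (2 * Real.pi + 2 * c) + (4 * c + 2 * Real.pi) + 1) * (1 + ‖ξ‖ ^ 2) := by
          have hx1 : ‖ξ‖ ≤ 1 + ‖ξ‖ ^ 2 := by nlinarith [sq_nonneg (‖ξ‖ - 1)]
          have hMc : M ξ = c * ‖ξ‖ := rfl
          rw [hMc]
          have ha : 0 ≤ 2 * c * (2 * Real.pi + 2 * c) := by positivity
          have hb : 0 ≤ 4 * c + 2 * Real.pi := by positivity
          have := mul_le_mul_of_nonneg_left hx1 hb
          nlinarith [sq_nonneg ‖ξ‖]
        have := mul_le_mul_of_nonneg_right hp (norm_nonneg (w ξ))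
        simp only [Pi.add_apply]
        linarith
    exact this.comp_fst _
  have hρbound : ∀ ξ, ∀ σ ∈ Set.Ioc (0 : ℝ) 1, ∀ y : ℝ, |y| ≤ 2 * Real.pi * ‖ξ‖ + 2 * M ξ + 1 →
      ‖ρ' (ξ, σ)‖ * |y| ≤
        28 * ((2 * M ξ + 1) * (2 * Real.pi * ‖ξ‖ + 2 * M ξ + 1) * ‖w ξ‖) := by
    intro ξ σ hσ y hy
    have h1 := norm_reluKernel_le (hS1 ξ σ hσ).1
    have h0 := hM0 ξ
    simp only [hρ', norm_mul, Complex.norm_exp_ofReal_mul_I, Complex.norm_real, mul_one]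
    rw [Real.norm_of_nonneg (by linarith : 0 ≤ 2 * M ξ + 1)]
    calc (2 * M ξ + 1) * (‖w ξ‖ * ‖reluKernel (S (ξ, σ))‖) * |y|
        ≤ (2 * M ξ + 1) * (‖w ξ‖ * 28) * (2 * Real.pi * ‖ξ‖ + 2 * M ξ + 1) := by gcongr
      _ = _ := by ring
  have hρle : ∀ p, |ρ p| ≤ ‖ρ' p‖ := fun p => Complex.abs_re_le_norm _
  obtain ⟨P, ω, hP, hω, hI, hIa, hInt⟩ := exists_isProbabilityMeasure_weight ν hρm
  -- With slope `2πξ` and bias `M - S`, the affine function is the shifted phase `2π⟪ξ,u⟫ + M` minus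
  -- the threshold `S`.
  set Φ : V × ℝ → ℝ × V × ℝ :=
    fun p => (ω p, (2 * Real.pi) • p.1, M p.1 - S p) with hΦ
  have hΦm : Measurable Φ := by
    fun_prop
  refine ⟨P.map Φ, Measure.isProbabilityMeasure_map hΦm.aemeasurable, ?_, fun u hu => ?_⟩
  · rw [integrable_map_measure (Measurable.aestronglyMeasurable (by fun_prop)) hΦm.aemeasurable]
    refine hIa (fun p => ‖(2 * Real.pi) • p.1‖ + |M p.1 - S p|) ?_
    refine hdom.mono' (Measurable.aestronglyMeasurable ?_) (hae fun ξ σ hσ => ?_)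
    · fun_prop
    · have h2 : ‖(2 * Real.pi) • ξ‖ = 2 * Real.pi * ‖ξ‖ := by
        rw [norm_smul, Real.norm_of_nonneg (by positivity)]
      have h3 := hρbound ξ σ hσ (‖(2 * Real.pi) • ξ‖ + |M ξ - S (ξ, σ)|) (by
        rw [abs_of_nonneg (by positivity), h2]; linarith [(hS1 ξ σ hσ).2, hM0 ξ])
      rw [norm_mul, Real.norm_eq_abs, Real.norm_eq_abs, abs_abs]
      exact (mul_le_mul_of_nonneg_right (hρle _) (abs_nonneg _)).trans h3
  · set t : V → ℝ := fun ξ => 2 * Real.pi * ⟪ξ, u⟫ with ht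
    have htM : ∀ ξ, |t ξ| ≤ M ξ := fun ξ => by
      simp only [ht, hM, abs_mul, abs_of_pos Real.pi_pos, Nat.abs_ofNat]
      have := abs_real_inner_le_norm ξ u
      have h2 : ‖ξ‖ * ‖u‖ ≤ R * ‖ξ‖ := by
        rw [mul_comm]; exact mul_le_mul_of_nonneg_right hu (norm_nonneg _)
      have := mul_le_mul_of_nonneg_left (this.trans h2) Real.two_pi_pos.le
      linarith
    set r : V × ℝ → ℝ := fun p => max (t p.1 + (M p.1 - S p)) 0 with hr
    have hrm : Measurable r := by
      simp only [hr, ht]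
      have h4 : Measurable fun p : V × ℝ => ⟪p.1, u⟫ :=
        (continuous_fst.inner continuous_const).measurable
      fun_prop
    have hcint : Integrable (fun p => ρ' p * (r p : ℂ)) ν := by
      refine hdom.mono' (Measurable.aestronglyMeasurable (by fun_prop)) (hae fun ξ σ hσ => ?_)
      have hy : |r (ξ, σ)| ≤ 2 * Real.pi * ‖ξ‖ + 2 * M ξ + 1 := by
        have h1 := abs_le.1 (htM ξ)
        have h2 := abs_le.1 (hS1 ξ σ hσ).2
        have h3 : 0 ≤ 2 * Real.pi * ‖ξ‖ := by positivity
        rw [abs_of_nonneg (le_max_right _ _)]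
        exact max_le (by linarith) (by linarith [hM0 ξ])
      rw [norm_mul, Complex.norm_real, Real.norm_eq_abs]
      exact hρbound ξ σ hσ _ hy
    have hρr : ∀ p, ρ p * r p = RCLike.re (ρ' p * (r p : ℂ)) := fun p => by
      simp [hρ]
    have hrint : Integrable (fun p => ρ p * r p) ν := by
      simp only [hρr]
      exact hcint.re
    have hΦr : ∀ p, (Φ p).1 * max (⟪(Φ p).2.1, u⟫ + (Φ p).2.2) 0 = ω p * r p := fun p => by
      simp only [hΦ, hr, ht, real_inner_smul_left]
    have hgm : Measurable fun θ : ℝ × V × ℝ => θ.1 * max (⟪θ.2.1, u⟫ + θ.2.2) 0 := by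
      have h4 : Measurable fun θ : ℝ × V × ℝ => ⟪θ.2.1, u⟫ :=
        ((continuous_fst.comp continuous_snd).inner continuous_const).measurable
      fun_prop
    constructor
    · rw [integrable_map_measure hgm.aestronglyMeasurable hΦm.aemeasurable]
      simp only [Function.comp_def, hΦr]
      exact hI _ hrint
    · rw [integral_map hΦm.aemeasurable hgm.aestronglyMeasurable]
      simp only [hΦr]
      rw [hInt]
      simp only [hρr]
      -- The real part is taken outside so that Fubini applies to the complex density; the inner
      -- integral over `σ` then recovers one plane wave.
      rw [integral_re hcint, hν, integral_prod _ hcint]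
      simp only [RCLike.re_eq_complex_re]
      congr 2
      ext ξ
      rw [← intervalIntegral.integral_of_le zero_le_one]
      have hinner : ∀ σ : ℝ, ρ' (ξ, σ) * (r (ξ, σ) : ℂ) =
          (w ξ * Complex.exp ((-M ξ : ℝ) * Complex.I)) * ((2 * M ξ + 1 : ℝ) •
            (fun s : ℝ => ((max (t ξ + M ξ - s) 0 : ℝ) : ℂ) * reluKernel s)
              (-1 + (2 * M ξ + 1) * σ)) := fun σ => by
        simp only [hρ', hr, hS, Complex.real_smul, add_sub_assoc]
        ring
      simp only [hinner]
      have h1 := abs_le.1 (htM ξ)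
      rw [intervalIntegral.integral_const_mul, intervalIntegral.integral_smul,
        intervalIntegral.smul_integral_comp_add_mul
          (fun s : ℝ => ((max (t ξ + M ξ - s) 0 : ℝ) : ℂ) * reluKernel s), mul_zero, mul_one, add_zero,
        integral_relu_mul_reluKernel (by linarith) (by linarith), mul_assoc, ← Complex.exp_add,
        mul_comm]
      congr 2
      simp only [ht]
      push_cast
      ring

end RecurrentBarron

/-! ### Fourier inversion and Sobolev regularity -/

namespace RecurrentBarron

open scoped FourierTransform RealInnerProductSpace
open TemperedDistribution

section Fourier

lemma continuous_neg_innerₗ {V : Type*} [NormedAddCommGroup V] [InnerProductSpace ℝ V] :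
    Continuous fun p : V × V => (-innerₗ V) p.1 p.2 :=
  (continuous_inner (𝕜 := ℝ) (E := V)).neg

variable {V : Type*} [NormedAddCommGroup V] [InnerProductSpace ℝ V] [FiniteDimensional ℝ V]
  [MeasurableSpace V] [BorelSpace V]

/-- Changing the sign of the pairing makes the general continuity and duality results for Fourier
integrals apply to the inverse transform. -/
lemma fourierInv_eq_vectorFourier (f : V → ℂ) :
    𝓕⁻ f = VectorFourier.fourierIntegral Real.fourierChar volume (-innerₗ V) f := by
  ext x
  simp [Real.fourierInv_eq, VectorFourier.fourierIntegral]

lemma continuous_fourierInv {f : V → ℂ} (hf : Integrable f) : Continuous (𝓕⁻ f) := by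
  rw [fourierInv_eq_vectorFourier]
  exact VectorFourier.fourierIntegral_continuous Real.continuous_fourierChar
    continuous_neg_innerₗ hf

lemma integral_fourierInv_mul_eq_flip {f g : V → ℂ} (hf : Integrable f) (hg : Integrable g) :
    ∫ ξ, 𝓕⁻ f ξ * g ξ = ∫ x, f x * 𝓕⁻ g x := by
  have h : (-innerₗ V).flip = -innerₗ V := by
    ext x y
    simp [real_inner_comm]
  rw [fourierInv_eq_vectorFourier, fourierInv_eq_vectorFourier]
  have := VectorFourier.integral_fourierIntegral_smul_eq_flip (L := -innerₗ V) (μ := volume)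
    (ν := volume) Real.continuous_fourierChar continuous_neg_innerₗ hf hg
  rw [h] at this
  exact this

/-- An `Lᵖ` function whose distributional Fourier transform is the integrable function `v` is the
inverse Fourier integral of `v`. -/
lemma ae_eq_fourierInv {p : ℝ≥0∞} [Fact (1 ≤ p)] (f : Lp ℂ p (volume : Measure V))
    (v : Lp ℂ 1 (volume : Measure V)) (h : 𝓕 (f : 𝓢'(V, ℂ)) = (v : 𝓢'(V, ℂ))) :
    f =ᵐ[volume] 𝓕⁻ (v : V → ℂ) := by
  have hv := L1.integrable_coeFn v
  refine ae_eq_of_integral_contDiff_smul_eq ((Lp.memLp f).locallyIntegrable Fact.out)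
    (continuous_fourierInv hv).locallyIntegrable fun g hg hgc => ?_
  have hg₁ : HasCompactSupport (Complex.ofRealCLM ∘ g) := hgc.comp_left rfl
  have hg₂ : ContDiff ℝ ((⊤ : ℕ∞) : WithTop ℕ∞) (Complex.ofRealCLM ∘ g) :=
    Complex.ofRealCLM.contDiff.comp hg
  set φ : 𝓢(V, ℂ) := hg₁.toSchwartzMap hg₂ with hφ
  have hφg : ∀ x, φ x = (g x : ℂ) := fun x => by simp [hφ]
  -- Duality: `⟨f, φ⟩ = ⟨𝓕 f, 𝓕⁻ φ⟩ = ⟨v, 𝓕⁻ φ⟩`, after which the inverse transform moves from `φ`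
  -- to `v`.
  have h1 : (f : 𝓢'(V, ℂ)) φ = (v : 𝓢'(V, ℂ)) (𝓕⁻ φ) := by
    rw [← h, TemperedDistribution.fourier_apply, FourierTransform.fourier_fourierInv_eq]
  simp only [Lp.toTemperedDistribution_apply, smul_eq_mul, hφg] at h1
  simp only [Complex.real_smul]
  rw [h1, SchwartzMap.fourierInv_coe, integral_fourierInv_mul_eq_flip φ.integrable hv]
  simp only [hφg]

/-- The Fourier transform of a function in `H^s`, `s > n/2 + 2`, has finite second moment. -/
lemma exists_fourier_second_moment {s : ℝ} (hs : (Module.finrank ℝ V : ℝ) / 2 + 2 < s)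
    {f : 𝓢'(V, ℂ)} (hf : MemSobolev s 2 f) :
    ∃ v : Lp ℂ 1 (volume : Measure V), 𝓕 f = (v : 𝓢'(V, ℂ)) ∧
      Integrable fun ξ => ‖ξ‖ ^ 2 * ‖v ξ‖ := by
  -- The Bessel potential of order 2 multiplies `𝓕 f` by `1 + ‖ξ‖²` and leaves regularity `s - 2 >
  -- n/2`, enough for an integrable transform `u`; then `v = u / (1 + ‖ξ‖²)`.
  have hf' : MemSobolev (s - 2) 2 (besselPotential V ℂ 2 f) := by
    rw [memSobolev_besselPotential_iff]
    convert! hf using 1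
    ring
  obtain ⟨u, hu⟩ := hf'.fourier_memL1 (by linarith)
  rw [fourier_besselPotential_eq_smulLeftCLM_fourier_apply] at hu
  have hgt : (fun x : V => (((1 + ‖x‖ ^ 2) ^ (-2 / 2 : ℝ) : ℝ) : ℂ)).HasTemperateGrowth := by
    fun_prop
  have hle : ∀ x : V, ‖(((1 + ‖x‖ ^ 2) ^ (-2 / 2 : ℝ) : ℝ) : ℂ)‖ ≤ 1 := fun x => by
    rw [Complex.norm_real, Real.norm_of_nonneg (by positivity)]
    exact Real.rpow_le_one_of_one_le_of_nonpos (by simp) (by norm_num)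
  have hmem : MemLp (fun x : V => (((1 + ‖x‖ ^ 2) ^ (-2 / 2 : ℝ) : ℝ) : ℂ)) ∞ volume :=
    memLp_top_of_bound hgt.1.continuous.aestronglyMeasurable 1 (Filter.Eventually.of_forall hle)
  refine ⟨hmem.toLp _ • u, ?_, ?_⟩
  · rw [Lp.toTemperedDistribution_smul_eq hgt, ← hu,
      smulLeftCLM_smulLeftCLM_apply (by fun_prop) hgt]
    convert! (smulLeftCLM_const 1 (𝓕 f)).symm using 1
    · simp
    · congr
      ext x
      rw [Pi.mul_apply, ← Complex.ofReal_mul, ← Real.rpow_add (by positivity)]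
      norm_num
  · refine (L1.integrable_coeFn u).norm.mono' ?_ ?_
    · have := (Lp.aestronglyMeasurable (hmem.toLp _ • u : Lp ℂ 1 (volume : Measure V))).norm
      exact (by fun_prop : Continuous fun ξ : V => ‖ξ‖ ^ 2).aestronglyMeasurable.mul this
    · filter_upwards [Lp.coeFn_lpSMul (r := 1) (hmem.toLp _) u, hmem.coeFn_toLp] with x h1 h2
      rw [h1, Pi.smul_apply', h2, smul_eq_mul, norm_mul, norm_norm, norm_mul,
        Complex.norm_real,
        Real.norm_of_nonneg (by positivity : (0 : ℝ) ≤ (1 + ‖x‖ ^ 2) ^ (-2 / 2 : ℝ)),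
        Real.norm_of_nonneg (by positivity), ← mul_assoc]
      refine mul_le_of_le_one_left (norm_nonneg _) ?_
      rw [show (-2 / 2 : ℝ) = -1 by norm_num, Real.rpow_neg_one, ← div_eq_mul_inv,
        div_le_one (by positivity)]
      linarith

end Fourier

end RecurrentBarron

/-! ### The shift register -/

namespace RecurrentBarron

section ShiftSystem

/-- The time `t - k`. -/
def delay (t : NonposInt) (k : ℕ) : NonposInt := ⟨t.1 - k, by have := t.2; omega⟩

lemma delay_zero (t : NonposInt) : delay t 0 = t := Subtype.ext (by simp [delay])

lemma delay_prev (t : NonposInt) (k : ℕ) : delay (prev t) k = delay t (k + 1) :=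
  Subtype.ext (by simp [delay, prev]; ring)

lemma delay_lag_zero (k : ℕ) : delay (lag 0) k = lag k := Subtype.ext (by simp [delay, lag])

lemma prev_lag_zero : prev (lag 0) = lag 1 := rfl

variable {T d : ℕ}

lemma shiftMatrix_mulVec (v : Fin (T * d) → ℝ) (i : Fin (T * d)) :
    (shiftMatrix T d).mulVec v i = if h : d ≤ i.1 then v ⟨i.1 - d, by omega⟩ else 0 := by
  simp only [Matrix.mulVec, dotProduct, shiftMatrix, ite_mul, one_mul, zero_mul]
  split_ifs with h
  · rw [Finset.sum_eq_single ⟨i.1 - d, by omega⟩]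
    · rw [if_pos (by simp; omega)]
    · intro j _ hj
      rw [if_neg]
      intro h'
      exact hj (Fin.ext (by simp; omega))
    · simp
  · exact Finset.sum_eq_zero fun j _ => if_neg (by omega)

lemma inputMatrix_mulVec (u : Fin d → ℝ) (i : Fin (T * d)) :
    (inputMatrix T d).mulVec u i = if h : i.1 < d then u ⟨i.1, h⟩ else 0 := by
  simp only [Matrix.mulVec, dotProduct, inputMatrix, ite_mul, one_mul, zero_mul]
  split_ifs with h
  · rw [Finset.sum_eq_single ⟨i.1, h⟩]
    · simp
    · intro j _ hj
      rw [if_neg]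
      intro h'
      exact hj (Fin.ext h'.symm)
    · simp
  · exact Finset.sum_eq_zero fun j _ => if_neg (by omega)

lemma isSolution_shift_iff {z : NonposInt → Vec d} {x : NonposInt → Vec (T * d)} :
    IsSolution (fun x => x) (shiftMatrix T d) 0 (inputMatrix T d) z x ↔
      ∀ t i, x t i = if h : i.1 < d then z t ⟨i.1, h⟩ else x (prev t) ⟨i.1 - d, by omega⟩ := by
  simp only [IsSolution, shiftMatrix_mulVec, inputMatrix_mulVec]
  refine forall_congr' fun t => forall_congr' fun i => ?_
  by_cases h : i.1 < d
  · simp [h, not_le.2 h]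
  · simp [h, not_lt.1 h]

/-- The state `(z_t, z_{t-1}, …, z_{t-T+1})` of the shift register. -/
noncomputable def shiftState (T : ℕ) (z : NonposInt → Vec d) (t : NonposInt) : Vec (T * d) :=
  stack fun k : Fin T => z (delay t k.1)

lemma shiftState_lag_zero (z : NonposInt → Vec d) :
    shiftState T z (lag 0) = stack fun k : Fin T => z (lag k.1) := by
  simp only [shiftState, delay_lag_zero]

lemma shiftState_apply (z : NonposInt → Vec d) (t : NonposInt) (i : Fin (T * d)) :
    shiftState T z t i = z (delay t (i.1 / d)) i.modNat := rfl

lemma isSolution_shiftState (z : NonposInt → Vec d) :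
    IsSolution (fun x => x) (shiftMatrix T d) 0 (inputMatrix T d) z (shiftState T z) := by
  rw [isSolution_shift_iff]
  intro t i
  have hd : 0 < d := Nat.pos_of_ne_zero fun h => by subst h; exact absurd i.2 (by simp)
  split_ifs with h
  · rw [shiftState_apply, Nat.div_eq_of_lt h, delay_zero]
    exact congrArg (z t) (Fin.ext (Nat.mod_eq_of_lt h))
  · rw [shiftState_apply, shiftState_apply, delay_prev]
    have h1 : i.1 / d = (i.1 - d) / d + 1 := Nat.div_eq_sub_div hd (not_lt.1 h)
    simp only [h1]
    exact congrArg (z (delay t _)) (Fin.ext (Nat.mod_eq_sub_mod (not_lt.1 h)))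

/-- The shift is nilpotent: entry `n` at time `t` is an input entry or entry `n - d` at time `t -
1`, so induction on `n` determines every solution, bounded or not. -/
lemma eq_of_isSolution_shift {z : NonposInt → Vec d} {x y : NonposInt → Vec (T * d)}
    (hx : IsSolution (fun x => x) (shiftMatrix T d) 0 (inputMatrix T d) z x)
    (hy : IsSolution (fun x => x) (shiftMatrix T d) 0 (inputMatrix T d) z y) : y = x := by
  rw [isSolution_shift_iff] at hx hy
  have key : ∀ n, ∀ t, ∀ h : n < T * d, y t ⟨n, h⟩ = x t ⟨n, h⟩ := by
    intro n
    induction n using Nat.strong_induction_on with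
    | _ n ih =>
      intro t h
      rw [hx, hy]
      have hd : 0 < d := Nat.pos_of_ne_zero fun h' => by subst h'; exact absurd h (by simp)
      split_ifs with hn
      · rfl
      · exact ih (n - d) (by simp at hn; omega) _ _
  ext t i
  exact key i.1 t i.2

lemma norm_shiftState_le {z : NonposInt → Vec d} {K : ℝ} (hz : ∀ t, ‖z t‖ ≤ K) (t : NonposInt) :
    ‖shiftState T z t‖ ≤ √((T * d : ℕ) * K ^ 2) := by
  refine Real.le_sqrt_of_sq_le ?_
  rw [EuclideanSpace.norm_sq_eq]
  refine (Finset.sum_le_card_nsmul _ _ (K ^ 2) fun i _ => ?_).trans_eq (by simp)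
  rw [shiftState_apply]
  exact pow_le_pow_left₀ (norm_nonneg _) ((PiLp.norm_apply_le _ _).trans (hz _)) 2

/-- The map `a ↦ Mᵀ a`. -/
noncomputable def transposeCLM {m n : ℕ} (M : Matrix (Fin m) (Fin n) ℝ) : Vec m →L[ℝ] Vec n :=
  ContinuousLinearMap.adjoint (LinearMap.toContinuousLinearMap (Matrix.toEuclideanLin M))

lemma inner_transposeCLM {m n : ℕ} (M : Matrix (Fin m) (Fin n) ℝ) (a : Vec m) (x : Vec n) :
    inner ℝ (transposeCLM M a) x = inner ℝ a (Matrix.toEuclideanLin M x) := by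
  rw [transposeCLM, ContinuousLinearMap.adjoint_inner_left]
  rfl

/-- The state equation at time `0`, paired with `a`: a readout of `x_0` becomes one of `x_{-1}` and
`z_0`. -/
lemma inner_shiftState_lag_zero (z : NonposInt → Vec d) (a : Vec (T * d)) :
    inner ℝ (transposeCLM (shiftMatrix T d) a) (shiftState T z (lag 1)) +
      inner ℝ (transposeCLM (inputMatrix T d) a) (z (lag 0)) =
      inner ℝ a (shiftState T z (lag 0)) := by
  rw [inner_transposeCLM, inner_transposeCLM, ← inner_add_right]
  congr 1
  ext i
  rw [isSolution_shiftState z (lag 0) i, prev_lag_zero]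
  simp [Matrix.toLpLin_apply]

/-- A readout representation on a ball of `ℝ^(Td)` gives a realization by the shift register. -/
lemma exists_isRealization_shift {I : Set (NonposInt → Vec d)} {K : ℝ}
    (hI : ∀ z ∈ I, ∀ t, ‖z t‖ ≤ K) {g : Vec (T * d) → ℝ} {μ : Measure (ℝ × Vec (T * d) × ℝ)}
    (hμ : IsProbabilityMeasure μ)
    (hmom : Integrable (fun θ : ℝ × Vec (T * d) × ℝ => |θ.1| * (‖θ.2.1‖ + |θ.2.2|)) μ)
    (hg : ∀ u : Vec (T * d), ‖u‖ ≤ √((T * d : ℕ) * K ^ 2) →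
      Integrable (fun θ : ℝ × Vec (T * d) × ℝ => θ.1 * max (inner ℝ θ.2.1 u + θ.2.2) 0) μ ∧
      ∫ θ : ℝ × Vec (T * d) × ℝ, θ.1 * max (inner ℝ θ.2.1 u + θ.2.2) 0 ∂μ = g u) :
    ∃ μ' : Measure (Params (T * d) d), IsRealization (fun x => x) (fun x => max x 0) I
      (shiftMatrix T d) 0 (inputMatrix T d) μ' (finiteMemory I g) := by
  set LA := transposeCLM (shiftMatrix T d)
  set LC := transposeCLM (inputMatrix T d)
  set Φ : ℝ × Vec (T * d) × ℝ → Params (T * d) d := fun θ => (θ.1, LA θ.2.1, LC θ.2.1, θ.2.2)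
    with hΦ
  have hΦm : Measurable Φ := by fun_prop
  refine ⟨μ.map Φ, Measure.isProbabilityMeasure_map hΦm.aemeasurable, ?_, fun z => ?_⟩
  · rw [integrable_map_measure (Measurable.aestronglyMeasurable (by fun_prop)) hΦm.aemeasurable]
    refine (hmom.const_mul (‖LA‖ + ‖LC‖ + 1)).mono'
      (Measurable.aestronglyMeasurable (by fun_prop)) (Filter.Eventually.of_forall fun θ => ?_)
    simp only [Function.comp_def, hΦ]
    rw [Real.norm_of_nonneg (by positivity)]
    have h1 := LA.le_opNorm θ.2.1
    have h2 := LC.le_opNorm θ.2.1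
    have h3 : ‖LA θ.2.1‖ + ‖LC θ.2.1‖ + |θ.2.2| ≤
        (‖LA‖ + ‖LC‖ + 1) * (‖θ.2.1‖ + |θ.2.2|) := by
      have : 0 ≤ (‖LA‖ + ‖LC‖) * |θ.2.2| := by positivity
      nlinarith [norm_nonneg θ.2.1]
    have := mul_le_mul_of_nonneg_left h3 (abs_nonneg θ.1)
    linarith
  · have hz := hI z.1 z.2
    obtain ⟨h1, h2⟩ := hg _ (norm_shiftState_le (T := T) hz (lag 0))
    have hr : ∀ θ, readout (fun x => max x 0) (shiftState T z.1 (lag 1)) (z.1 (lag 0)) (Φ θ) =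
        θ.1 * max (inner ℝ θ.2.1 (shiftState T z.1 (lag 0)) + θ.2.2) 0 := fun θ => by
      simp only [readout, hΦ, ← inner_shiftState_lag_zero]
      rfl
    have hrm : Measurable
        (readout (fun x => max x 0) (shiftState T z.1 (lag 1)) (z.1 (lag 0))) := by
      have e1 : Measurable fun θ : Params (T * d) d =>
          inner ℝ θ.2.1 (shiftState T z.1 (lag 1)) := by fun_prop
      have e2 : Measurable fun θ : Params (T * d) d => inner ℝ θ.2.2.1 (z.1 (lag 0)) := by
        fun_prop
      unfold readout
      fun_prop
    refine ⟨shiftState T z.1, ⟨memℓp_infty ⟨√((T * d : ℕ) * K ^ 2), ?_⟩, isSolution_shiftState z.1⟩,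
      fun y _ hy => eq_of_isSolution_shift (isSolution_shiftState z.1) hy, ?_, ?_⟩
    · rintro _ ⟨t, rfl⟩
      exact norm_shiftState_le hz t
    · rw [integrable_map_measure hrm.aestronglyMeasurable hΦm.aemeasurable]
      simpa only [Function.comp_def, hr] using h1
    · rw [integral_map hΦm.aemeasurable hrm.aestronglyMeasurable]
      simp only [hr]
      rw [h2, finiteMemory, shiftState_lag_zero]

end ShiftSystem

/-! ### Assembly -/

/-- A function in `H^s(ℝ^n)`, `s > n/2 + 2`, is almost everywhere the real part of a superposition of
plane waves with finite second spectral moment. -/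
lemma MemHs.exists_planeWave {n : ℕ} {s : ℝ} (hs : (n : ℝ) / 2 + 2 < s) {h : Vec n → ℝ}
    (hh : MemHs s h) :
    ∃ w : Vec n → ℂ, Measurable w ∧ Integrable w ∧ (Integrable fun ξ => ‖ξ‖ ^ 2 * ‖w ξ‖) ∧
      Continuous (fun u =>
        (∫ ξ, Complex.exp ((2 * Real.pi * inner ℝ ξ u : ℝ) * Complex.I) * w ξ).re) ∧
      (fun u => (∫ ξ, Complex.exp ((2 * Real.pi * inner ℝ ξ u : ℝ) * Complex.I) * w ξ).re)
        =ᵐ[volume] h := by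
  obtain ⟨hL, hS⟩ := hh
  obtain ⟨v, hv, hv2⟩ := exists_fourier_second_moment (by simpa using hs) hS
  have hvi := L1.integrable_coeFn v
  have e : ∀ u : Vec n, (∫ ξ, Complex.exp ((2 * Real.pi * inner ℝ ξ u : ℝ) * Complex.I) * v ξ) =
      FourierTransformInv.fourierInv (v : Vec n → ℂ) u := fun u => by
    rw [Real.fourierInv_eq']
    rfl
  refine ⟨v, (Lp.stronglyMeasurable v).measurable, hvi, hv2, ?_, ?_⟩
  · simp only [e]
    exact Complex.continuous_re.comp (continuous_fourierInv hvi)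
  · filter_upwards [ae_eq_fourierInv _ v hv, hL.coeFn_toLp] with u h1 h2
    rw [e, ← h1, h2, Complex.ofReal_re]

end RecurrentBarron

theorem mainTheorem6 (d T : ℕ) (hd : 1 ≤ d) (hT : 1 ≤ T)
    (D : Set (RecurrentBarron.Vec d)) (hD : Bornology.IsBounded D)
    (I : Set (RecurrentBarron.NonposInt → RecurrentBarron.Vec d))
    (hI : ∀ z ∈ I, ∀ t, z t ∈ D)
    (s : ℝ) (hs : ((T * d : ℕ) : ℝ) / 2 + 2 < s)
    (h : RecurrentBarron.Vec (T * d) → ℝ) (hh : RecurrentBarron.MemHs s h) :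
    -- the class of `h` has a continuous representative ...
    (∃ g : RecurrentBarron.Vec (T * d) → ℝ, Continuous g ∧ g =ᵐ[volume] h) ∧
    -- ... and `H` is defined through it; if `h` is itself continuous, then `g = h`
    ∀ g : RecurrentBarron.Vec (T * d) → ℝ, Continuous g → g =ᵐ[volume] h →
      RecurrentBarron.IsFiniteDimBarron (fun x => x) (fun x => max x 0) I
        (RecurrentBarron.finiteMemory I g) ∧
      ∃ μ : Measure (RecurrentBarron.Params (T * d) d),
        RecurrentBarron.IsRealization (fun x => x) (fun x => max x 0) I
          (RecurrentBarron.shiftMatrix T d) 0 (RecurrentBarron.inputMatrix T d) μ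
          (RecurrentBarron.finiteMemory I g) := by

  obtain ⟨w, hw, hw0, hw2, hc, hae⟩ := hh.exists_planeWave hs
  refine ⟨⟨_, hc, hae⟩, fun g hg hgh => ?_⟩
  -- Continuous functions that agree almost everywhere are equal, so `g` is the plane-wave
  -- superposition at every point.
  obtain rfl := (hg.ae_eq_iff_eq volume hc).1 (hgh.trans hae.symm)
  obtain ⟨K, hK⟩ := hD.exists_norm_le
  obtain ⟨μ, hμ, hmom, hrep⟩ :=
    -- This radius bounds every state of the register, since each of its `T * d` entries is at most
    -- `K` in absolute value.
    RecurrentBarron.exists_relu_representation hw hw0 hw2 (Real.sqrt_nonneg ((T * d : ℕ) * K ^ 2))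
  obtain ⟨μ', hμ'⟩ := RecurrentBarron.exists_isRealization_shift (T := T)
    (fun z hz t => hK _ (hI z hz t)) hμ hmom hrep
  exact ⟨⟨T * d, Nat.mul_pos hT hd, μ', _, _, _, hμ'⟩, μ', hμ'⟩
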